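/- Let $G=(V,E)$ be a finite directed graph (self-loops allowed) with out-matrix $H$: $H(v,u)>0$ if $(v,u)\in E$, $H(v,u)=0$ otherwise, and $\sum_{u}H(v,u)=1$ for every $v\in V$. A configuration $s$ assigns to each node one of the states agnostic, red, blue (the last two are called gnostic). Consider the pull voter model with agnostic nodes, i.e. the Markov chain $(S_t)_{t\ge 0}$ of configurations with the following rounds. When a node $v$ pulls, it chooses a node $u$ with probability $H(v,u)$; if $u$ is agnostic, $v$ keeps its state, and if $u$ is gnostic, $v$ adopts the colour of $u$. In the synchronous model all nodes pull simultaneously and independently in each round; in the asynchronous model a single node, chosen uniformly at random, pulls in each round. Let $\mu=(\mu(v))_{v\in V}$ be a real row vector with $\mu H=\mu$, and suppose that $H$ is reversible with respect to $\mu$: $\mu(v)H(v,w)=\mu(w)H(w,v)$ for all $v,w\in V$. For $t\ge 0$ let $R_t(v)$ be the event that the state of $v$ at the first time $k\ge t$ at which $v$ is gnostic exists and is red (so, if $v$ is gnostic at time $t$, the event that $v$ is red at time $t$), and put $$X_t=\sum_{v\in V}\mu(v)\,\mathbb P\bigl(R_t(v)\mid S_t\bigr).$$ Then, in the synchronous and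 in the asynchronous model and for every law of $S_0$, $(X_t)_{t\ge0}$ is a martingale with respect to the filtration generated by $(S_t)_{t\ge 0}$. Moreover, suppose that $\sum_v\mu(v)=1$ and that the process converges almost surely, i.e. almost surely there is a time $t$ at which all nodes are in the same state. Then $\mathbb P(\text{red wins}\mid S_0)=X_0$ almost surely, where red wins if at some time all nodes are red. In particular, if the initial configuration $S_0$ is deterministic, then $\mathbb P(\text{red wins})=X_0$ (almost surely). -/

import Mathlib

open MeasureTheory ProbabilityTheory

/-- The state of a node: agnostic (white), or gnostic with colour red or blue. -/
inductive Opinion where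
  | agnostic
  | red
  | blue
  deriving DecidableEq

namespace AgnosticVoter

instance : MeasurableSpace Opinion := ⊤

/-- Synchronous protocol: every node pulls in each round.  Asynchronous protocol: one node, chosen
uniformly at random, pulls in each round. -/
inductive Protocol where
  | synchronous
  | asynchronous

/-- A configuration assigns a state to each node. -/
abbrev Config (V : Type*) := V → Opinion

/-- `H` is the out-matrix of the weighted directed graph `G` (self-loops allowed): the edges are
exactly the pairs of positive weight, and the weights of the edges leaving a node sum to `1`. -/
structure IsOutMatrix {V : Type*} [Fintype V] (G : Digraph V) (H : Matrix V V ℝ) : Prop where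
  pos_of_adj : ∀ v u, G.Adj v u → 0 < H v u
  zero_of_not_adj : ∀ v u, ¬ G.Adj v u → H v u = 0
  sum_row : ∀ v, ∑ u, H v u = 1

/-- The new state of a node in state `own` that has chosen a neighbour in state `seen`. -/
def pull (own : Opinion) : Opinion → Opinion
  | .agnostic => own
  | .red => .red
  | .blue => .blue

/-- The configuration after a synchronous round in which each node `v` has chosen node `c v`. -/
def syncUpdate {V : Type*} (s : Config V) (c : V → V) : Config V :=
  fun v => pull (s v) (s (c v))

/-- The configuration after an asynchronous round in which node `v` has been selected and has
chosen node `u`. -/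
def asyncUpdate {V : Type*} [DecidableEq V] (s : Config V) (v u : V) : Config V :=
  Function.update s v (pull (s v) (s u))

/-- The one-round transition probability from `s` to `s'`.  In the synchronous case the choices of
the nodes are independent and node `v` chooses `u` with probability `H v u`; in the asynchronous
case a uniformly random node `v` is selected and chooses `u` with probability `H v u`. -/
noncomputable def stepProb {V : Type*} [Fintype V] [DecidableEq V] (H : Matrix V V ℝ) :
    Protocol → Config V → Config V → ℝ
  | .synchronous, s, s' =>
      ∑ c : V → V, if syncUpdate s c = s' then ∏ v, H v (c v) else 0
  | .asynchronous, s, s' =>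
      ∑ v : V, ∑ u : V, if asyncUpdate s v u = s' then (Fintype.card V : ℝ)⁻¹ * H v u else 0

/-- `S` is a pull voter model with agnostic nodes: the time-homogeneous Markov chain with the
transition probabilities `stepProb H π`, started from an arbitrary initial law. -/
structure IsVoterModel {V Ω : Type*} [Fintype V] [DecidableEq V] [MeasurableSpace Ω]
    (H : Matrix V V ℝ) (π : Protocol) (P : Measure Ω) (S : ℕ → Ω → Config V) : Prop where
  measurable : ∀ t, Measurable (S t)
  markov : ∀ (t : ℕ) (s : ℕ → Config V),
    P.real {ω | ∀ k ≤ t + 1, S k ω = s k} =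
      P.real {ω | ∀ k ≤ t, S k ω = s k} * stepProb H π (s t) (s (t + 1))

/-- The σ-algebra generated by `S t`. -/
abbrev sigmaAt {V Ω : Type*} (S : ℕ → Ω → Config V) (t : ℕ) : MeasurableSpace Ω :=
  MeasurableSpace.comap (S t) inferInstance

/-- The filtration generated by the process `S`. -/
def history {V Ω : Type*} [mΩ : MeasurableSpace Ω] (S : ℕ → Ω → Config V)
    (hS : ∀ t, Measurable (S t)) : Filtration ℕ mΩ where
  seq t := ⨆ k ≤ t, sigmaAt S k
  mono' := fun _ _ hij => biSup_mono fun _ hk => hk.trans hij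
  le' := fun _ => iSup₂_le fun k _ => (hS k).comap_le

/-- The event, for the process observed from time `t` on, that node `v` is coloured red once it is
gnostic: the first gnostic state of `v` at a time `k ≥ t` is red. In particular, if `v` is gnostic
at time `t`, the event says that `v` is red at time `t`. -/
def redOnceGnostic {V Ω : Type*} (S : ℕ → Ω → Config V) (t : ℕ) (v : V) : Set Ω :=
  {ω | ∃ k, t ≤ k ∧ S k ω v = .red ∧ ∀ j, t ≤ j → j < k → S j ω v = .agnostic}

/-- `X t = ∑ v, μ v * P(R(v) | S t)`. -/
noncomputable def redInfluence {V Ω : Type*} [Fintype V] [MeasurableSpace Ω]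
    (μ : V → ℝ) (P : Measure Ω) (S : ℕ → Ω → Config V) (t : ℕ) (ω : Ω) : ℝ :=
  ∑ v, μ v * (P⟦redOnceGnostic S t v | sigmaAt S t⟧) ω

/-- The event that red wins: the configuration with all nodes red is reached. -/
def redWins {V Ω : Type*} (S : ℕ → Ω → Config V) : Set Ω :=
  {ω | ∃ t, ∀ v, S t ω v = .red}

/-- The process converges almost surely: consensus (all nodes in the same state) is reached. -/
def Converges {V Ω : Type*} [MeasurableSpace Ω] (P : Measure Ω) (S : ℕ → Ω → Config V) : Prop :=
  ∀ᵐ ω ∂P, ∃ (t : ℕ) (c : Opinion), ∀ v, S t ω v = c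

end AgnosticVoter

/-!
In a reversible model the weight `μ v * H v w` of an edge is symmetric. Let `W t` be the total
`μ`-weight of the nodes that are red once they are gnostic, observed from time `t` on. A node that
is agnostic at time `t` contributes equally to `W t` and `W (t + 1)`. A gnostic node `v` changes its
contribution only by pulling a gnostic node `w` of the other colour, and the expected change, which
is proportional to `μ v * H v w`, cancels against that of `w` pulling `v`. Hence
`W (t + 1) - W t` has mean zero given the history up to time `t`. By the Markov property the
conditional expectation of `W t` given this history is `redInfluence` at time `t`, which is
therefore a martingale. If consensus is reached, `W t` is eventually the total weight or zero
according to whether red wins, and dominated convergence gives the probability that red wins.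
-/

open Filter Topology Matrix

section ConditionalExpectation

variable {Ω β E : Type*} {m mΩ : MeasurableSpace Ω} {P : Measure Ω} [MeasurableSpace β]
  [NormedAddCommGroup E] {Y : Ω → β}

theorem condExp_comap_ae_eq_integral_of_ae_eq_const [NormedSpace ℝ E] [CompleteSpace E]
    [IsProbabilityMeasure P] (hY : Measurable Y) {b : β} (hb : ∀ᵐ ω ∂P, Y ω = b)
    {f : Ω → E} (hf : StronglyMeasurable f) :
    P[f | MeasurableSpace.comap Y inferInstance] =ᵐ[P] fun _ => ∫ ω, f ω ∂P := by
  have hindep : IndepFun id Y P :=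
    (indepFun_const_right id b).congr EventuallyEq.rfl (hb.mono fun _ => Eq.symm)
  rw [IndepFun_iff_Indep, MeasurableSpace.comap_id] at hindep
  exact condExp_indep_eq le_rfl hY.comap_le hf hindep

theorem measureReal_inter_eq_mul_of_condExp_eq [IsFiniteMeasure P] (hm : m ≤ mΩ) {A B : Set Ω}
    (hA : MeasurableSet[m] A) (hB : MeasurableSet B) {c : ℝ}
    (h : ∀ᵐ ω ∂P, ω ∈ A → (P⟦B | m⟧) ω = c) : P.real (A ∩ B) = P.real A * c :=
  calc
    P.real (A ∩ B) = ∫ ω in A, B.indicator (fun _ => 1) ω ∂P := by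
      rw [setIntegral_indicator hB, setIntegral_one_eq_measureReal]
    _ = ∫ ω in A, (P⟦B | m⟧) ω ∂P :=
      (setIntegral_condExp hm ((integrable_const 1).indicator hB) hA).symm
    _ = ∫ _ in A, c ∂P := setIntegral_congr_ae (hm A hA) h
    _ = P.real A * c := by rw [setIntegral_const, smul_eq_mul]

theorem cond_inter_eq_mul {A B D : Set Ω} (hD : MeasurableSet D)
    (h : P.real D * P.real (D ∩ (A ∩ B)) = P.real (D ∩ A) * P.real (D ∩ B)) :
    P[A ∩ B | D] = P[A | D] * P[B | D] := by
  have hcond : ∀ C, P[C | D].toReal = (P.real D)⁻¹ * P.real (D ∩ C) := fun C => by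
    simp [measureReal_def, cond_apply hD]
  rw [← ENNReal.toReal_eq_toReal_iff' (by finiteness) (by finiteness), ENNReal.toReal_mul, hcond,
    hcond, hcond, mul_mul_mul_comm, ← h]
  by_cases hzero : P.real D = 0
  · simp [hzero]
  · field_simp

variable [Finite β] [MeasurableSingletonClass β] [IsFiniteMeasure P]

theorem integrable_comp_of_finite (hY : Measurable Y) (f : β → E) :
    Integrable (fun ω => f (Y ω)) P :=
  (Integrable.of_finite (f := f) (μ := P.map Y)).comp_measurable hY

theorem setIntegral_comp_eq_sum [NormedSpace ℝ E] [Fintype β] [CompleteSpace E] (hY : Measurable Y)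
    (f : β → E) (A : Set Ω) :
    ∫ ω in A, f (Y ω) ∂P = ∑ b, P.real (A ∩ Y ⁻¹' {b}) • f b := by
  rw [← integral_map hY.aemeasurable (Integrable.of_finite (f := f)).aestronglyMeasurable,
    integral_fintype .of_finite]
  simp only [map_measureReal_apply hY (measurableSet_singleton _),
    measureReal_restrict_apply (hY (measurableSet_singleton _)), Set.inter_comm A]

theorem condExp_comap_ae_eq_comp_of_setIntegral_fiber_eq [NormedSpace ℝ E] [CompleteSpace E]
    (hY : Measurable Y) {f : Ω → E} (hf : Integrable f P) {g : β → E}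
    (h : ∀ b, ∫ ω in Y ⁻¹' {b}, f ω ∂P = P.real (Y ⁻¹' {b}) • g b) :
    P[f | MeasurableSpace.comap Y inferInstance] =ᵐ[P] fun ω => g (Y ω) := by
  have := Fintype.ofFinite β
  have hg : Integrable (fun ω => g (Y ω)) P := integrable_comp_of_finite hY g
  refine (ae_eq_condExp_of_forall_setIntegral_eq hY.comap_le hf (fun _ _ _ => hg.integrableOn)
    ?_ ?_).symm
  · rintro _ ⟨B, -, rfl⟩ -
    have hfiber : Y ⁻¹' B = ⋃ b ∈ B.toFinite.toFinset, Y ⁻¹' {b} := by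
      ext; simp
    have hmeas : ∀ b ∈ B.toFinite.toFinset, MeasurableSet (Y ⁻¹' {b}) := fun b _ =>
      hY (measurableSet_singleton b)
    have hdisj : Set.Pairwise (B.toFinite.toFinset : Set β)
        (Function.onFun Disjoint fun b => Y ⁻¹' {b}) := fun b _ b' _ hbb' =>
      (Set.disjoint_singleton.2 hbb').preimage Y
    rw [hfiber, integral_biUnion_finset _ hmeas hdisj fun _ _ => hg.integrableOn,
      integral_biUnion_finset _ hmeas hdisj fun _ _ => hf.integrableOn]
    refine Finset.sum_congr rfl fun b hb => ?_
    rw [h, setIntegral_congr_fun (hmeas b hb) fun ω hω => congrArg g hω, setIntegral_const]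
  · exact (StronglyMeasurable.of_discrete.comp_measurable
      (comap_measurable Y)).aestronglyMeasurable

end ConditionalExpectation

/-- `X` is a Markov chain with transition probabilities `p` with respect to the filtration `ℱ`. The
one-round Markov property is stated for test functions: `(p *ᵥ f) a` is the expectation of `f` after
one round from `a`. -/
structure IsMarkovChain {α Ω : Type*} [Fintype α] [MeasurableSpace α] {mΩ : MeasurableSpace Ω}
    (p : Matrix α α ℝ) (ℱ : Filtration ℕ mΩ) (P : Measure Ω) (X : ℕ → Ω → α) : Prop where
  measurable_filtration : ∀ t, Measurable[ℱ t] (X t)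
  condExp_comp_succ : ∀ (f : α → ℝ) (t : ℕ),
    P[fun ω => f (X (t + 1) ω) | ℱ t] =ᵐ[P] fun ω => (p *ᵥ f) (X t ω)

/-- The σ-algebra of the events that depend only on the process `X` from time `t` on. -/
abbrev futureSigma {α Ω : Type*} [MeasurableSpace α] (X : ℕ → Ω → α) (t : ℕ) : MeasurableSpace Ω :=
  ⨆ k ∈ Set.Ici t, MeasurableSpace.comap (X k) inferInstance

section Future

variable {α Ω : Type*} [mα : MeasurableSpace α] [mΩ : MeasurableSpace Ω] {X : ℕ → Ω → α} {t : ℕ}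

theorem futureSigma_le (hX : ∀ k, Measurable (X k)) : futureSigma X t ≤ mΩ :=
  iSup₂_le fun k _ => (hX k).comap_le

omit mΩ in
theorem measurable_futureSigma {k : ℕ} (hk : t ≤ k) : Measurable[futureSigma X t] (X k) :=
  measurable_iff_comap_le.2 <|
    le_iSup₂_of_le (f := fun k (_ : k ∈ Set.Ici t) => mα.comap (X k)) k hk le_rfl

omit mΩ in
theorem exists_eq_cylinder_of_mem_piiUnionInter {E : Set Ω}
    (hE : E ∈ piiUnionInter (fun k => {A | MeasurableSet[mα.comap (X k)] A}) (Set.Ici t)) :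
    ∃ (n : ℕ) (B : ℕ → Set α), E = {ω | ∀ k < n, X (t + k) ω ∈ B k} := by
  obtain ⟨I, hI, A, hA, rfl⟩ := hE
  choose! B _ hB using hA
  refine ⟨I.sup id + 1, fun k => {a | t + k ∈ I → a ∈ B (t + k)}, ?_⟩
  ext ω
  simp only [Set.mem_iInter, Set.mem_ofPred_eq]
  constructor
  · intro h k _ hk
    have := h _ hk
    rwa [← hB _ hk] at this
  · intro h k hk
    obtain ⟨j, rfl⟩ := Nat.exists_eq_add_of_le (hI hk)
    have hj : t + j ≤ I.sup id := Finset.le_sup (f := id) hk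
    rw [← hB _ hk]
    exact h j (by omega) hk

end Future

namespace IsMarkovChain

variable {α Ω : Type*} [Fintype α] [mα : MeasurableSpace α]
  {mΩ : MeasurableSpace Ω} {p : Matrix α α ℝ} {ℱ : Filtration ℕ mΩ} {P : Measure Ω}
  {X : ℕ → Ω → α}

theorem measurable (hX : IsMarkovChain p ℱ P X) (t : ℕ) : Measurable (X t) :=
  (hX.measurable_filtration t).mono (ℱ.le t) le_rfl

variable [MeasurableSingletonClass α]

theorem stronglyMeasurable_comp (hX : IsMarkovChain p ℱ P X) (f : α → ℝ) (t : ℕ) :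
    StronglyMeasurable[ℱ t] fun ω => f (X t ω) :=
  StronglyMeasurable.of_discrete.comp_measurable (hX.measurable_filtration t)

variable [IsFiniteMeasure P]

theorem condExp_comp_mul (hX : IsMarkovChain p ℱ P X) (f : α → ℝ) (t : ℕ) {Z : Ω → ℝ}
    (hZ : Integrable Z P) :
    P[fun ω => f (X t ω) * Z ω | ℱ t] =ᵐ[P] fun ω => f (X t ω) * P[Z | ℱ t] ω := by
  refine condExp_stronglyMeasurable_mul_of_bound (ℱ.le t) (hX.stronglyMeasurable_comp f t) hZ
    (∑ a, ‖f a‖) (ae_of_all _ fun ω => ?_)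
  exact Finset.single_le_sum (f := fun a => ‖f a‖) (fun _ _ => norm_nonneg _) (Finset.mem_univ _)

theorem condExp_comp_pair (hX : IsMarkovChain p ℱ P X) (F : α → α → ℝ) (t : ℕ) :
    P[fun ω => F (X t ω) (X (t + 1) ω) | ℱ t] =ᵐ[P] fun ω => (p *ᵥ F (X t ω)) (X t ω) := by
  classical
  have hint : ∀ a, Integrable (fun ω => F a (X (t + 1) ω)) P := fun a =>
    integrable_comp_of_finite (hX.measurable _) (F a)
  have hsum : (fun ω => F (X t ω) (X (t + 1) ω)) =
      ∑ a, fun ω => (Pi.single a 1 : α → ℝ) (X t ω) * F a (X (t + 1) ω) := by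
    ext ω
    simp [Pi.single_apply]
  have hterm : ∀ a, P[fun ω => (Pi.single a 1 : α → ℝ) (X t ω) * F a (X (t + 1) ω) | ℱ t] =ᵐ[P]
      fun ω => (Pi.single a 1 : α → ℝ) (X t ω) * (p *ᵥ F a) (X t ω) := fun a =>
    (hX.condExp_comp_mul (Pi.single a 1) t (hint a)).trans <|
      (hX.condExp_comp_succ (F a) t).mono fun ω hω => by simp only [hω]
  rw [hsum]
  refine (condExp_finsetSum (fun a _ => ?_) _).trans ?_
  · exact integrable_comp_of_finite ((hX.measurable t).prodMk (hX.measurable (t + 1)))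
      fun x : α × α => (Pi.single a 1 : α → ℝ) x.1 * F a x.2
  · filter_upwards [ae_all_iff.2 hterm] with ω hω
    rw [Finset.sum_apply]
    simp only [hω]
    simp [Pi.single_apply]

theorem ae_transition_ne_zero (hX : IsMarkovChain p ℱ P X) :
    ∀ᵐ ω ∂P, ∀ t, p (X t ω) (X (t + 1) ω) ≠ 0 := by
  classical
  refine ae_all_iff.2 fun t => ?_
  let F : α → α → ℝ := fun a b => if p a b = 0 then 1 else 0
  have hF : Integrable (fun ω => F (X t ω) (X (t + 1) ω)) P :=
    integrable_comp_of_finite ((hX.measurable t).prodMk (hX.measurable (t + 1)))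
      fun x : α × α => F x.1 x.2
  have hmean : ∀ a, (p *ᵥ F a) a = 0 := fun a =>
    Finset.sum_eq_zero fun b _ => by simp [F]
  have hzero : ∫ ω, F (X t ω) (X (t + 1) ω) ∂P = 0 := by
    rw [← integral_condExp (ℱ.le t), integral_congr_ae (hX.condExp_comp_pair F t)]
    simp [hmean]
  rw [integral_eq_zero_iff_of_nonneg (fun ω => by simp only [F]; positivity) hF] at hzero
  filter_upwards [hzero] with ω hω
  simpa [F] using hω

theorem exists_condExp_cylinder_ae_eq_comp (hX : IsMarkovChain p ℱ P X) (n : ℕ) (B : ℕ → Set α)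
    (t : ℕ) :
    ∃ g : α → ℝ, P⟦{ω | ∀ k < n, X (t + k) ω ∈ B k} | ℱ t⟧ =ᵐ[P] fun ω => g (X t ω) := by
  classical
  induction n generalizing B t with
  | zero => exact ⟨fun _ => 1, by simp [condExp_const (ℱ.le t)]⟩
  | succ n ih =>
    obtain ⟨g, hg⟩ := ih (fun k => B (k + 1)) (t + 1)
    set C : Set Ω := {ω | ∀ k < n, X (t + 1 + k) ω ∈ B (k + 1)} with hC
    have hCmeas : MeasurableSet C := by
      simp only [hC, Set.ofPred_forall]
      exact .iInter fun k => .iInter fun _ => hX.measurable _ (Set.toFinite _).measurableSet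
    have hnext : P⟦C | ℱ t⟧ =ᵐ[P] fun ω => (p *ᵥ g) (X t ω) :=
      (condExp_condExp_of_le (ℱ.mono t.le_succ) (ℱ.le (t + 1))).symm.trans
        ((condExp_congr_ae hg).trans (hX.condExp_comp_succ g t))
    have hsplit : {ω | ∀ k < n + 1, X (t + k) ω ∈ B k}.indicator (fun _ => (1 : ℝ)) =
        fun ω => (B 0).indicator 1 (X t ω) * C.indicator (fun _ => 1) ω := by
      ext ω
      simp [-Order.lt_add_one_iff, Set.indicator_apply, Nat.forall_lt_succ_left', hC, add_assoc,
        add_comm 1, ← ite_and, and_comm]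
    refine ⟨fun a => (B 0).indicator 1 a * (p *ᵥ g) a, ?_⟩
    rw [hsplit]
    filter_upwards [hX.condExp_comp_mul ((B 0).indicator 1) t
      ((integrable_const 1).indicator hCmeas), hnext] with ω hmul hω
    rw [hmul, hω]

theorem indep_cond (hX : IsMarkovChain p ℱ P X) (t : ℕ) (a : α) :
    Indep (ℱ t) (futureSigma X t) P[|X t ⁻¹' {a}] := by
  have hle := futureSigma_le (t := t) hX.measurable
  have hgen := generateFrom_piiUnionInter_measurableSet (fun k => mα.comap (X k)) (Set.Ici t)
  refine IndepSets.indep (ℱ.le t) hle (@MeasurableSpace.isPiSystem_measurableSet Ω (ℱ t))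
    (isPiSystem_piiUnionInter _
      (fun k => @MeasurableSpace.isPiSystem_measurableSet Ω (mα.comap (X k))) _)
    (@MeasurableSpace.generateFrom_measurableSet Ω (ℱ t)).symm hgen.symm ?_
  refine (IndepSets_iff _ _ _).2 fun A C hA hC => ?_
  have hD := hX.measurable t (measurableSet_singleton a)
  have hCmeas : MeasurableSet C := hle _ (hgen.le _ (MeasurableSpace.measurableSet_generateFrom hC))
  obtain ⟨g, hg⟩ : ∃ g : α → ℝ, P⟦C | ℱ t⟧ =ᵐ[P] fun ω => g (X t ω) := by
    obtain ⟨n, B, rfl⟩ := exists_eq_cylinder_of_mem_piiUnionInter hC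
    exact hX.exists_condExp_cylinder_ae_eq_comp n B t
  have hmul : ∀ A, MeasurableSet[ℱ t] A →
      P.real (X t ⁻¹' {a} ∩ A ∩ C) = P.real (X t ⁻¹' {a} ∩ A) * g a := fun A hA =>
    measureReal_inter_eq_mul_of_condExp_eq (ℱ.le t)
      ((hX.measurable_filtration t (measurableSet_singleton a)).inter hA) hCmeas
      (hg.mono fun ω hω hωA => hω.trans (congrArg g hωA.1))
  have hmul_univ := hmul .univ .univ
  rw [Set.inter_univ] at hmul_univ
  refine cond_inter_eq_mul hD ?_
  rw [← Set.inter_assoc, hmul A hA, hmul_univ, mul_left_comm]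

theorem condExp_futureSigma_ae_eq (hX : IsMarkovChain p ℱ P X) (t : ℕ) {E : Set Ω}
    (hE : MeasurableSet[futureSigma X t] E) :
    P⟦E | ℱ t⟧ =ᵐ[P] fun ω => P[|X t ⁻¹' {X t ω}].real E := by
  have hEmeas : MeasurableSet E := futureSigma_le hX.measurable E hE
  let g : α → ℝ := fun a => P[|X t ⁻¹' {a}].real E
  have hmul : ∀ A, MeasurableSet[ℱ t] A → ∀ a,
      P.real (A ∩ X t ⁻¹' {a}) * g a = P.real (A ∩ E ∩ X t ⁻¹' {a}) := by
    intro A hA a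
    have hD := hX.measurable t (measurableSet_singleton a)
    have h := (Indep_iff _ _ _).1 (hX.indep_cond t a) A E hA hE
    have := congrArg ENNReal.toReal (congrArg (· * P (X t ⁻¹' {a})) h)
    rw [cond_mul_eq_inter hD, mul_right_comm, cond_mul_eq_inter hD] at this
    simpa [g, Set.inter_comm, measureReal_def] using this.symm
  refine (ae_eq_condExp_of_forall_setIntegral_eq (ℱ.le t) ((integrable_const 1).indicator hEmeas)
    (fun _ _ _ => (integrable_comp_of_finite (hX.measurable t) g).integrableOn) (fun A hA _ => ?_)
    (hX.stronglyMeasurable_comp g t).aestronglyMeasurable).symm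
  calc
    ∫ ω in A, g (X t ω) ∂P = ∑ a, P.real (A ∩ E ∩ X t ⁻¹' {a}) := by
      simp only [setIntegral_comp_eq_sum (hX.measurable t), smul_eq_mul, hmul A hA]
    _ = ∫ _ in A ∩ E, 1 ∂P := by
      rw [setIntegral_comp_eq_sum (hX.measurable t) (fun _ => (1 : ℝ))]
      simp only [smul_eq_mul, mul_one]
    _ = ∫ ω in A, E.indicator (fun _ => 1) ω ∂P := (setIntegral_indicator hEmeas).symm

theorem condExp_futureSigma_ae_eq_condExp_comap (hX : IsMarkovChain p ℱ P X) (t : ℕ) {E : Set Ω}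
    (hE : MeasurableSet[futureSigma X t] E) :
    P⟦E | ℱ t⟧ =ᵐ[P] P⟦E | mα.comap (X t)⟧ := by
  have h := hX.condExp_futureSigma_ae_eq t hE
  have hle : mα.comap (X t) ≤ (ℱ t : MeasurableSpace Ω) :=
    (hX.measurable_filtration t).comap_le
  have hcomap : P[fun ω => P[|X t ⁻¹' {X t ω}].real E | mα.comap (X t)] = _ :=
    condExp_of_stronglyMeasurable (hX.measurable t).comap_le
      ((StronglyMeasurable.of_discrete (f := fun a => P[|X t ⁻¹' {a}].real E)).comp_measurable
        (comap_measurable (X t)))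
      (integrable_comp_of_finite (hX.measurable t) fun a => P[|X t ⁻¹' {a}].real E)
  calc
    P⟦E | ℱ t⟧ =ᵐ[P] fun ω => P[|X t ⁻¹' {X t ω}].real E := h
    _ =ᵐ[P] P[P⟦E | ℱ t⟧ | mα.comap (X t)] :=
      ((condExp_congr_ae h).trans (.of_eq hcomap)).symm
    _ =ᵐ[P] P⟦E | mα.comap (X t)⟧ :=
      condExp_condExp_of_le hle (ℱ.le t)

end IsMarkovChain

section PathProbability

variable {α Ω : Type*} [mα : MeasurableSpace α] {mΩ : MeasurableSpace Ω} {X : ℕ → Ω → α}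

omit mΩ in
theorem comap_path_eq_iSup_comap (X : ℕ → Ω → α) (t : ℕ) :
    MeasurableSpace.comap (fun ω (k : Set.Iic t) => X k ω) inferInstance =
      ⨆ k ≤ t, mα.comap (X k) := by
  simp only [MeasurableSpace.pi, MeasurableSpace.comap_iSup, MeasurableSpace.comap_comp,
    iSup_subtype, Set.mem_Iic, Function.comp_def]

variable [Fintype α] [MeasurableSingletonClass α] {P : Measure Ω} [IsFiniteMeasure P]
  {p : Matrix α α ℝ} {t : ℕ}

theorem setIntegral_path_comp_succ (hX : ∀ t, Measurable (X t))
    (hpath : ∀ s : ℕ → α, P.real {ω | ∀ k ≤ t + 1, X k ω = s k} =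
      P.real {ω | ∀ k ≤ t, X k ω = s k} * p (s t) (s (t + 1))) (f : α → ℝ) (s : ℕ → α) :
    ∫ ω in {ω | ∀ k ≤ t, X k ω = s k}, f (X (t + 1) ω) ∂P =
      P.real {ω | ∀ k ≤ t, X k ω = s k} * (p *ᵥ f) (s t) := by
  have hstep : ∀ b, P.real ({ω | ∀ k ≤ t, X k ω = s k} ∩ X (t + 1) ⁻¹' {b}) =
      P.real {ω | ∀ k ≤ t, X k ω = s k} * p (s t) b := by
    intro b
    have hne : ∀ k ≤ t, Function.update s (t + 1) b k = s k := fun k hk =>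
      Function.update_of_ne (by lia) _ _
    have h := hpath (Function.update s (t + 1) b)
    simp only [Nat.le_add_one_iff, or_imp, forall_and, forall_eq, Set.ofPred_and] at h
    simpa +contextual [hne, Set.preimage] using h
  simp only [setIntegral_comp_eq_sum (hX _), hstep, Matrix.mulVec, dotProduct, Finset.mul_sum,
    smul_eq_mul, mul_assoc]

theorem condExp_comp_succ_of_path_probability (hX : ∀ t, Measurable (X t))
    (hpath : ∀ s : ℕ → α, P.real {ω | ∀ k ≤ t + 1, X k ω = s k} =
      P.real {ω | ∀ k ≤ t, X k ω = s k} * p (s t) (s (t + 1))) (f : α → ℝ) :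
    P[fun ω => f (X (t + 1) ω) | ⨆ k ≤ t, mα.comap (X k)] =ᵐ[P] fun ω => (p *ᵥ f) (X t ω) := by
  have hfiber : ∀ b : Set.Iic t → α, (fun ω (k : Set.Iic t) => X k ω) ⁻¹' {b} =
      {ω | ∀ k ≤ t, X k ω = b ⟨min k t, min_le_right k t⟩} := by
    intro b
    ext ω
    simp +contextual [funext_iff]
  rw [← comap_path_eq_iSup_comap]
  refine condExp_comap_ae_eq_comp_of_setIntegral_fiber_eq
    (g := fun b : Set.Iic t → α => (p *ᵥ f) (b ⟨t, Set.self_mem_Iic⟩))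
    (measurable_pi_lambda _ fun k : Set.Iic t => hX k) (integrable_comp_of_finite (hX _) f)
    fun b => ?_
  rw [hfiber, setIntegral_path_comp_succ hX hpath]
  simp only [min_self, smul_eq_mul]

end PathProbability

namespace AgnosticVoter

instance : Fintype Opinion := ⟨{.agnostic, .red, .blue}, by rintro (_ | _ | _) <;> simp⟩

theorem pull_self (a : Opinion) : pull a a = a := by
  cases a <;> rfl

theorem pull_ne_agnostic {a : Opinion} (ha : a ≠ .agnostic) (b : Opinion) :
    pull a b ≠ .agnostic := by
  cases b <;> simp [pull, ha]

/-- The indicator of the state red. -/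
def redValue (a : Opinion) : ℝ :=
  if a = .red then 1 else 0

/-- The change of `redValue` when a node in state `a` pulls from a node in state `b`, provided that
`a` is gnostic; it is set to `0` for agnostic `a`, which makes it antisymmetric. -/
def redGap (a b : Opinion) : ℝ :=
  if a = .agnostic ∨ b = .agnostic then 0 else redValue b - redValue a

theorem redGap_eq_neg (a b : Opinion) : redGap a b = -redGap b a := by
  simp only [redGap, or_comm]
  split_ifs <;> ring

theorem redValue_pull_sub_redValue {a : Opinion} (ha : a ≠ .agnostic) (b : Opinion) :
    redValue (pull a b) - redValue a = redGap a b := by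
  cases b <;> simp [redGap, pull, ha]

section Transition

variable {V : Type*} [Fintype V] [DecidableEq V] {H : Matrix V V ℝ} {π : Protocol}

/-- The transition matrix of the voter model. -/
noncomputable def stepMatrix (H : Matrix V V ℝ) (π : Protocol) : Matrix (Config V) (Config V) ℝ :=
  .of (stepProb H π)

theorem exists_eq_pull_of_stepMatrix_ne_zero {s s' : Config V} (h : stepMatrix H π s s' ≠ 0)
    (v : V) : ∃ u, s' v = pull (s v) (s u) := by
  cases π with
  | synchronous =>
    obtain ⟨c, -, hc⟩ := Finset.exists_ne_zero_of_sum_ne_zero h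
    obtain ⟨rfl, -⟩ := ite_ne_right_iff.1 hc
    exact ⟨c v, rfl⟩
  | asynchronous =>
    obtain ⟨w, -, hw⟩ := Finset.exists_ne_zero_of_sum_ne_zero h
    obtain ⟨u, -, hu⟩ := Finset.exists_ne_zero_of_sum_ne_zero hw
    obtain ⟨rfl, -⟩ := ite_ne_right_iff.1 hu
    obtain rfl | hvw := eq_or_ne v w
    · exact ⟨u, Function.update_self ..⟩
    · exact ⟨v, by rw [asyncUpdate, Function.update_of_ne hvw, pull_self]⟩

theorem stepMatrix_synchronous_mulVec (f : Config V → ℝ) (s : Config V) :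
    (stepMatrix H .synchronous *ᵥ f) s =
      ∑ c : V → V, (∏ v, H v (c v)) * f (syncUpdate s c) := by
  simp only [stepMatrix, mulVec, dotProduct, of_apply, stepProb, Finset.sum_mul]
  rw [Finset.sum_comm]
  simp [ite_mul]

theorem stepMatrix_asynchronous_mulVec (f : Config V → ℝ) (s : Config V) :
    (stepMatrix H .asynchronous *ᵥ f) s =
      ∑ v, ∑ u, (Fintype.card V : ℝ)⁻¹ * H v u * f (asyncUpdate s v u) := by
  simp only [stepMatrix, mulVec, dotProduct, of_apply, stepProb, Finset.sum_mul]
  rw [Finset.sum_comm]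
  refine Finset.sum_congr rfl fun v _ => ?_
  rw [Finset.sum_comm]
  simp [ite_mul]

theorem stepMatrix_synchronous_mulVec_comp_eval (hrow : ∀ v, ∑ u, H v u = 1) (f : Opinion → ℝ)
    (v : V) (s : Config V) :
    (stepMatrix H .synchronous *ᵥ fun s' => f (s' v)) s =
      ∑ u, H v u * f (pull (s v) (s u)) := by
  have hfactor : (∏ w, ∑ u, H w u * if w = v then f (pull (s v) (s u)) else 1) =
      ∑ c : V → V, (∏ w, H w (c w)) * f (pull (s v) (s (c v))) := by
    simp only [Fintype.prod_sum, Finset.prod_mul_distrib, Finset.prod_ite_eq', Finset.mem_univ,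
      if_true]
  rw [stepMatrix_synchronous_mulVec]
  simp only [syncUpdate]
  rw [← hfactor, ← Finset.mul_prod_erase _ _ (Finset.mem_univ v), Finset.prod_eq_one, mul_one]
  · simp only [if_true]
  · intro w hw
    simp only [Finset.ne_of_mem_erase hw, if_false, mul_one, hrow]

theorem stepMatrix_asynchronous_mulVec_comp_eval (hrow : ∀ v, ∑ u, H v u = 1) (f : Opinion → ℝ)
    (v : V) (s : Config V) :
    (stepMatrix H .asynchronous *ᵥ fun s' => f (s' v)) s =
      (1 - (Fintype.card V : ℝ)⁻¹) * f (s v) +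
        (Fintype.card V : ℝ)⁻¹ * ∑ u, H v u * f (pull (s v) (s u)) := by
  have hcard : (Fintype.card V : ℝ) ≠ 0 :=
    Nat.cast_ne_zero.2 (Fintype.card_pos_iff.2 ⟨v⟩).ne'
  have hother : ∀ w ∈ Finset.univ.erase v,
      ∑ u, (Fintype.card V : ℝ)⁻¹ * H w u * f (asyncUpdate s w u v) =
        (Fintype.card V : ℝ)⁻¹ * f (s v) := fun w hw => by
    simp only [asyncUpdate, Function.update_of_ne (Finset.ne_of_mem_erase hw).symm]
    rw [← Finset.sum_mul, ← Finset.mul_sum, hrow, mul_one]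
  rw [stepMatrix_asynchronous_mulVec, ← Finset.sum_erase_add _ _ (Finset.mem_univ v),
    Finset.sum_congr rfl hother, Finset.sum_const, Finset.card_erase_of_mem (Finset.mem_univ v),
    Finset.card_univ, nsmul_eq_mul, Nat.cast_sub (Fintype.card_pos_iff.2 ⟨v⟩)]
  congr 1
  · field_simp
    simp only [Nat.cast_one, mul_comm]
  · simp only [asyncUpdate, Function.update_self, Finset.mul_sum, mul_assoc]

/-- The probability that a given node pulls in a given round. -/
noncomputable def pullRate (V : Type*) [Fintype V] : Protocol → ℝ
  | .synchronous => 1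
  | .asynchronous => (Fintype.card V : ℝ)⁻¹

theorem stepMatrix_mulVec_comp_eval (hrow : ∀ v, ∑ u, H v u = 1) (f : Opinion → ℝ) (v : V)
    (s : Config V) :
    (stepMatrix H π *ᵥ fun s' => f (s' v)) s =
      (1 - pullRate V π) * f (s v) + pullRate V π * ∑ u, H v u * f (pull (s v) (s u)) := by
  cases π with
  | synchronous =>
    simp [pullRate, stepMatrix_synchronous_mulVec_comp_eval hrow]
  | asynchronous => exact stepMatrix_asynchronous_mulVec_comp_eval hrow f v s

/-- The change of the red indicator of `v` in a round from `s` to `s'`, counted only if `v` was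
already gnostic: becoming gnostic does not change the colour that `v` shows once it is gnostic. -/
noncomputable def redGain (v : V) (s s' : Config V) : ℝ :=
  if s v = .agnostic then 0 else redValue (s' v) - redValue (s v)

theorem stepMatrix_mulVec_redGain (hrow : ∀ v, ∑ u, H v u = 1) (v : V) (s : Config V) :
    (stepMatrix H π *ᵥ redGain v s) s = pullRate V π * ∑ u, H v u * redGap (s v) (s u) := by
  by_cases hv : s v = .agnostic
  · simp [mulVec, dotProduct, redGain, redGap, hv]
  · have hgain : redGain v s = fun s' => redValue (s' v) - redValue (s v) := by
      ext s'
      exact if_neg hv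
    rw [hgain, stepMatrix_mulVec_comp_eval hrow (fun a => redValue a - redValue (s v))]
    simp only [sub_self, mul_zero, zero_add, redValue_pull_sub_redValue hv]

/-- Under reversibility the flow of red weight along each edge is antisymmetric, so the total
cancels. -/
theorem stepMatrix_mulVec_sum_smul_redGain (hrow : ∀ v, ∑ u, H v u = 1) {μ : V → ℝ}
    (hrev : ∀ v w, H v w * μ v = H w v * μ w) (s : Config V) :
    (stepMatrix H π *ᵥ ∑ v, μ v • redGain v s) s = 0 := by
  let flow : V → V → ℝ := fun v u => H v u * μ v * redGap (s v) (s u)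
  have hanti : ∀ v u, flow v u = -flow u v := fun v u => by
    simp only [flow]
    rw [hrev v u, redGap_eq_neg, mul_neg]
  have hflow : ∑ v, ∑ u, flow v u = 0 := by
    refine self_eq_neg.1 ?_
    conv_lhs => rw [Finset.sum_comm]
    simp only [← Finset.sum_neg_distrib, ← hanti]
  calc
    (stepMatrix H π *ᵥ ∑ v, μ v • redGain v s) s =
        ∑ v, μ v * (pullRate V π * ∑ u, H v u * redGap (s v) (s u)) := by
      simp only [mulVec_sum, mulVec_smul, Finset.sum_apply, Pi.smul_apply, smul_eq_mul,
        stepMatrix_mulVec_redGain hrow]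
    _ = pullRate V π * ∑ v, ∑ u, flow v u := by
      simp only [flow, Finset.mul_sum]
      exact Finset.sum_congr rfl fun v _ => Finset.sum_congr rfl fun u _ => by ring
    _ = 0 := by rw [hflow, mul_zero]

end Transition

section Trajectory

variable {V Ω : Type*} {S : ℕ → Ω → Config V} {ω : Ω} {t : ℕ} {v : V}

/-- A trajectory of the voter model in which the new state of each node results from pulling some
node; a node that does not pull counts as pulling itself. -/
def IsPullPath (s : ℕ → Config V) : Prop :=
  ∀ t v, ∃ u, s (t + 1) v = pull (s t v) (s t u)

theorem IsPullPath.eq_of_le {s : ℕ → Config V} (hs : IsPullPath s) {c : Opinion}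
    (hc : ∀ v, s t v = c) {k : ℕ} (hk : t ≤ k) (v : V) : s k v = c := by
  induction k, hk using Nat.le_induction generalizing v with
  | base => exact hc v
  | succ k _ ih =>
    obtain ⟨u, hu⟩ := hs k v
    rw [hu, ih, ih, pull_self]

theorem mem_redOnceGnostic_iff :
    ω ∈ redOnceGnostic S t v ↔
      S t ω v = .red ∨ S t ω v = .agnostic ∧ ω ∈ redOnceGnostic S (t + 1) v := by
  constructor
  · rintro ⟨k, hk, hred, hbefore⟩
    obtain rfl | hlt := hk.eq_or_lt
    · exact .inl hred
    · exact .inr ⟨hbefore t le_rfl hlt, k, hlt, hred, fun j hj => hbefore j (by lia)⟩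
  · rintro (hred | ⟨hagn, k, hk, hred, hbefore⟩)
    · exact ⟨t, le_rfl, hred, fun j hj hjt => by lia⟩
    · refine ⟨k, by lia, hred, fun j hj hjk => ?_⟩
      obtain rfl | hlt := hj.eq_or_lt
      exacts [hagn, hbefore j hlt hjk]

theorem indicator_redOnceGnostic_of_ne_agnostic (h : S t ω v ≠ .agnostic) :
    (redOnceGnostic S t v).indicator (fun _ => (1 : ℝ)) ω = redValue (S t ω v) := by
  classical
  simp [Set.indicator_apply, redValue, mem_redOnceGnostic_iff (t := t), h]

theorem indicator_redOnceGnostic_succ (hpull : IsPullPath fun t => S t ω) (t : ℕ) (v : V) :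
    (redOnceGnostic S (t + 1) v).indicator (fun _ => (1 : ℝ)) ω =
      (redOnceGnostic S t v).indicator (fun _ => 1) ω + redGain v (S t ω) (S (t + 1) ω) := by
  by_cases h : S t ω v = .agnostic
  · classical
    simp [Set.indicator_apply, redGain, mem_redOnceGnostic_iff (t := t), h]
  · have hsucc : S (t + 1) ω v ≠ .agnostic := by
      obtain ⟨u, hu⟩ := hpull t v
      exact hu.trans_ne (pull_ne_agnostic h _)
    rw [indicator_redOnceGnostic_of_ne_agnostic h, indicator_redOnceGnostic_of_ne_agnostic hsucc,
      redGain, if_neg h, add_sub_cancel]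

theorem eventually_mem_redOnceGnostic_iff (hpull : IsPullPath fun t => S t ω)
    (hcons : ∃ (t : ℕ) (c : Opinion), ∀ v, S t ω v = c) (v : V) :
    ∀ᶠ t in atTop, (ω ∈ redOnceGnostic S t v ↔ ω ∈ redWins S) := by
  obtain ⟨T, c, hc⟩ := hcons
  have hconst : ∀ k ≥ T, ∀ w, S k ω w = c := fun k hk => hpull.eq_of_le hc hk
  have hwins : ω ∈ redWins S ↔ c = .red := by
    refine ⟨fun ⟨t, ht⟩ => ?_, fun h => ⟨T, fun w => (hc w).trans h⟩⟩
    rw [← hconst (max t T) (le_max_right t T) v]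
    exact hpull.eq_of_le ht (le_max_left t T) v
  filter_upwards [eventually_ge_atTop T] with t ht
  rw [hwins]
  refine ⟨fun ⟨k, hk, hred, _⟩ => (hconst k (ht.trans hk) v).symm.trans hred, fun h => ?_⟩
  exact mem_redOnceGnostic_iff.2 (.inl ((hconst t ht v).trans h))

variable [Fintype V] {μ : V → ℝ}

/-- The total weight of the nodes that are red once they are gnostic; its conditional expectation
given the present is `redInfluence`. -/
noncomputable def redWeight (μ : V → ℝ) (S : ℕ → Ω → Config V) (t : ℕ) : Ω → ℝ :=
  ∑ v, μ v • (redOnceGnostic S t v).indicator fun _ => 1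

theorem redWeight_succ (hpull : IsPullPath fun t => S t ω) (t : ℕ) :
    redWeight μ S (t + 1) ω =
      redWeight μ S t ω + (∑ v, μ v • redGain v (S t ω)) (S (t + 1) ω) := by
  simp only [redWeight, Finset.sum_apply, Pi.smul_apply, indicator_redOnceGnostic_succ hpull,
    smul_add, Finset.sum_add_distrib]

theorem norm_redWeight_le (t : ℕ) (ω : Ω) : ‖redWeight μ S t ω‖ ≤ ∑ v, ‖μ v‖ := by
  rw [redWeight, Finset.sum_apply]
  refine (norm_sum_le _ _).trans (Finset.sum_le_sum fun v _ => ?_)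
  rw [Pi.smul_apply, norm_smul]
  refine mul_le_of_le_one_right (norm_nonneg _) ?_
  exact (norm_indicator_le_norm_self _ _).trans_eq norm_one

theorem tendsto_redWeight (hpull : IsPullPath fun t => S t ω)
    (hcons : ∃ (t : ℕ) (c : Opinion), ∀ v, S t ω v = c) :
    Tendsto (fun t => redWeight μ S t ω) atTop
      (𝓝 ((∑ v, μ v) * (redWins S).indicator (fun _ => 1) ω)) := by
  refine tendsto_const_nhds.congr' ?_
  classical
  filter_upwards [eventually_all.2 fun v => eventually_mem_redOnceGnostic_iff hpull hcons v]
    with t ht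
  simp [redWeight, Set.indicator_apply, ht]

end Trajectory

section Chain

variable {V Ω : Type*} [Fintype V] [DecidableEq V] [mΩ : MeasurableSpace Ω] {P : Measure Ω}
  {H : Matrix V V ℝ} {π : Protocol} {S : ℕ → Ω → Config V} {μ : V → ℝ}

omit [Fintype V] [DecidableEq V] mΩ in
theorem measurableSet_redOnceGnostic (S : ℕ → Ω → Config V) (t : ℕ) (v : V) :
    MeasurableSet[futureSigma S t] (redOnceGnostic S t v) := by
  have hnode : ∀ k ≥ t, ∀ a, MeasurableSet[futureSigma S t] {ω | S k ω v = a} := fun k hk a =>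
    measurable_futureSigma hk
      ((measurable_pi_apply v : Measurable fun s : Config V => s v) (measurableSet_singleton a))
  have hunion : redOnceGnostic S t v =
      ⋃ k ≥ t, {ω | S k ω v = .red} ∩ ⋂ j ∈ Set.Ico t k, {ω | S j ω v = .agnostic} := by
    ext ω
    simp [redOnceGnostic, and_left_comm]
  rw [hunion]
  exact .biUnion (Set.to_countable _) fun k hk => (hnode k hk _).inter <|
    .biInter (Set.to_countable _) fun j hj => hnode j hj.1 _

omit [Fintype V] [DecidableEq V] in
theorem measurableSet_redWins [Finite V] (hm : ∀ t, Measurable (S t)) :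
    MeasurableSet (redWins S) := by
  have hunion : redWins S = ⋃ t, S t ⁻¹' {fun _ => .red} := by
    ext ω
    simp [redWins, funext_iff]
  rw [hunion]
  exact .iUnion fun t => hm t (measurableSet_singleton _)

omit [Fintype V] [DecidableEq V] in
theorem sigmaAt_le_history (hm : ∀ t, Measurable (S t)) (t : ℕ) :
    sigmaAt S t ≤ history S hm t :=
  le_iSup₂_of_le (f := fun k (_ : k ≤ t) => sigmaAt S k) t le_rfl le_rfl

omit [Fintype V] [DecidableEq V] in
theorem history_zero (hm : ∀ t, Measurable (S t)) : history S hm 0 = sigmaAt S 0 := by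
  simp [history]

variable [IsFiniteMeasure P]

theorem IsVoterModel.isMarkovChain (hS : IsVoterModel H π P S) :
    IsMarkovChain (stepMatrix H π) (history S hS.measurable) P S where
  measurable_filtration t := measurable_iff_comap_le.2 (sigmaAt_le_history hS.measurable t)
  condExp_comp_succ f t := condExp_comp_succ_of_path_probability hS.measurable (hS.markov t) f

theorem IsVoterModel.ae_isPullPath (hS : IsVoterModel H π P S) :
    ∀ᵐ ω ∂P, IsPullPath fun t => S t ω :=
  hS.isMarkovChain.ae_transition_ne_zero.mono fun _ hω t =>
    exists_eq_pull_of_stepMatrix_ne_zero (hω t)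

omit [DecidableEq V] in
theorem integrable_redWeight (hm : ∀ t, Measurable (S t)) (t : ℕ) :
    Integrable (redWeight μ S t) P :=
  integrable_finsetSum' _ fun v _ => ((integrable_const 1).indicator
    (futureSigma_le hm _ (measurableSet_redOnceGnostic S t v))).smul (μ v)

theorem condExp_redWeight_self (hS : IsVoterModel H π P S) (t : ℕ) :
    P[redWeight μ S t | history S hS.measurable t] =ᵐ[P] redInfluence μ P S t := by
  have hnode : ∀ v, P[μ v • (redOnceGnostic S t v).indicator (fun _ => (1 : ℝ)) |
      history S hS.measurable t] =ᵐ[P] μ v • P⟦redOnceGnostic S t v | sigmaAt S t⟧ := fun v =>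
    (condExp_smul _ _ _).trans <| (hS.isMarkovChain.condExp_futureSigma_ae_eq_condExp_comap t
      (measurableSet_redOnceGnostic S t v)).const_smul (μ v)
  refine (condExp_finsetSum (fun v _ => ((integrable_const 1).indicator
    (futureSigma_le hS.measurable _ (measurableSet_redOnceGnostic S t v))).smul (μ v)) _).trans ?_
  filter_upwards [ae_all_iff.2 hnode] with ω hω
  simp only [redInfluence, Finset.sum_apply, hω, Pi.smul_apply, smul_eq_mul]

theorem condExp_redWeight_succ (hS : IsVoterModel H π P S) (hrow : ∀ v, ∑ u, H v u = 1)
    (hrev : ∀ v w, H v w * μ v = H w v * μ w) (t : ℕ) :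
    P[redWeight μ S (t + 1) | history S hS.measurable t] =ᵐ[P]
      P[redWeight μ S t | history S hS.measurable t] := by
  let gain : Config V → Config V → ℝ := fun s => ∑ v, μ v • redGain v s
  have hgain : P[fun ω => gain (S t ω) (S (t + 1) ω) | history S hS.measurable t] =ᵐ[P] 0 :=
    (hS.isMarkovChain.condExp_comp_pair gain t).trans <|
      .of_eq <| funext fun ω => stepMatrix_mulVec_sum_smul_redGain hrow hrev (S t ω)
  have hint : Integrable (fun ω => gain (S t ω) (S (t + 1) ω)) P :=
    integrable_comp_of_finite ((hS.measurable t).prodMk (hS.measurable (t + 1)))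
      fun x : Config V × Config V => gain x.1 x.2
  calc
    P[redWeight μ S (t + 1) | history S hS.measurable t] =ᵐ[P]
        P[redWeight μ S t + fun ω => gain (S t ω) (S (t + 1) ω) | history S hS.measurable t] :=
      condExp_congr_ae (hS.ae_isPullPath.mono fun ω hω => redWeight_succ hω t)
    _ =ᵐ[P] P[redWeight μ S t | history S hS.measurable t] +
        P[fun ω => gain (S t ω) (S (t + 1) ω) | history S hS.measurable t] :=
      condExp_add (integrable_redWeight hS.measurable t) hint _
    _ =ᵐ[P] P[redWeight μ S t | history S hS.measurable t] + 0 := .add .rfl hgain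
    _ = P[redWeight μ S t | history S hS.measurable t] := add_zero _

theorem martingale_redInfluence (hS : IsVoterModel H π P S) (hrow : ∀ v, ∑ u, H v u = 1)
    (hrev : ∀ v w, H v w * μ v = H w v * μ w) :
    Martingale (redInfluence μ P S) (history S hS.measurable) P := by
  have hsum : ∀ t, redInfluence μ P S t =
      ∑ v, μ v • P⟦redOnceGnostic S t v | sigmaAt S t⟧ := fun t => by
    ext ω
    simp [redInfluence]
  refine martingale_nat (fun t => ?_) (fun t => ?_) fun t => ?_
  · rw [hsum]
    exact Finset.stronglyMeasurable_sum _ fun v _ =>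
      (stronglyMeasurable_condExp.mono (sigmaAt_le_history hS.measurable t)).const_smul (μ v)
  · rw [hsum]
    exact integrable_finsetSum' _ fun v _ => integrable_condExp.smul (μ v)
  · calc
      redInfluence μ P S t =ᵐ[P] P[redWeight μ S t | history S hS.measurable t] :=
        (condExp_redWeight_self hS t).symm
      _ =ᵐ[P] P[redWeight μ S (t + 1) | history S hS.measurable t] :=
        (condExp_redWeight_succ hS hrow hrev t).symm
      _ =ᵐ[P] P[P[redWeight μ S (t + 1) | history S hS.measurable (t + 1)] |
          history S hS.measurable t] :=
        (condExp_condExp_of_le (Filtration.mono _ t.le_succ) (Filtration.le _ _)).symm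
      _ =ᵐ[P] P[redInfluence μ P S (t + 1) | history S hS.measurable t] :=
        condExp_congr_ae (condExp_redWeight_self hS (t + 1))

theorem condExp_redWeight (hS : IsVoterModel H π P S) (hrow : ∀ v, ∑ u, H v u = 1)
    (hrev : ∀ v w, H v w * μ v = H w v * μ w) {t n : ℕ} (htn : t ≤ n) :
    P[redWeight μ S n | history S hS.measurable t] =ᵐ[P] redInfluence μ P S t :=
  calc
    P[redWeight μ S n | history S hS.measurable t] =ᵐ[P]
        P[P[redWeight μ S n | history S hS.measurable n] | history S hS.measurable t] :=
      (condExp_condExp_of_le (Filtration.mono _ htn) (Filtration.le _ _)).symm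
    _ =ᵐ[P] P[redInfluence μ P S n | history S hS.measurable t] :=
      condExp_congr_ae (condExp_redWeight_self hS n)
    _ =ᵐ[P] redInfluence μ P S t := (martingale_redInfluence hS hrow hrev).condExp_ae_eq htn

theorem condExp_redWins (hS : IsVoterModel H π P S) (hrow : ∀ v, ∑ u, H v u = 1)
    (hrev : ∀ v w, H v w * μ v = H w v * μ w) (hsum : ∑ v, μ v = 1) (hconv : Converges P S) :
    P⟦redWins S | sigmaAt S 0⟧ =ᵐ[P] redInfluence μ P S 0 := by
  have hlim : ∀ᵐ ω ∂P, Tendsto (fun t => redWeight μ S t ω) atTop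
      (𝓝 ((redWins S).indicator (fun _ => 1) ω)) := by
    filter_upwards [hS.ae_isPullPath, hconv] with ω hpull hcons
    simpa only [hsum, one_mul] using tendsto_redWeight (μ := μ) hpull hcons
  have hzero := condExp_redWeight_self (μ := μ) hS 0
  have hstep : ∀ n, P[redWeight μ S n | sigmaAt S 0] =ᵐ[P] P[redWeight μ S 0 | sigmaAt S 0] :=
    fun n => by
      rw [← history_zero hS.measurable]
      exact (condExp_redWeight hS hrow hrev n.zero_le).trans hzero.symm
  rw [history_zero] at hzero
  refine .trans ?_ hzero
  exact tendsto_condExp_unique (redWeight μ S) (fun _ => redWeight μ S 0) _ _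
    (integrable_redWeight hS.measurable) (fun _ => integrable_redWeight hS.measurable 0) hlim
    (ae_of_all _ fun _ => tendsto_const_nhds) _ (integrable_const (∑ v, ‖μ v‖)) _
    (integrable_const (∑ v, ‖μ v‖)) (fun n => ae_of_all _ (norm_redWeight_le n))
    (fun _ => ae_of_all _ (norm_redWeight_le 0)) hstep

end Chain

end AgnosticVoter

theorem theorem1 {V Ω : Type*} [Fintype V] [DecidableEq V] [MeasurableSpace Ω]
    (P : Measure Ω) [IsProbabilityMeasure P]
    (G : Digraph V) (H : Matrix V V ℝ) (hH : AgnosticVoter.IsOutMatrix G H)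
    (μ : V → ℝ) (hμ : Matrix.vecMul μ H = μ)
    (hrev : ∀ v w, H v w * μ v = H w v * μ w)
    (π : AgnosticVoter.Protocol) (S : ℕ → Ω → AgnosticVoter.Config V)
    (hS : AgnosticVoter.IsVoterModel H π P S) :
    Martingale (AgnosticVoter.redInfluence μ P S) (AgnosticVoter.history S hS.measurable) P ∧
    (∑ v, μ v = 1 → AgnosticVoter.Converges P S →
      P⟦AgnosticVoter.redWins S | AgnosticVoter.sigmaAt S 0⟧
          =ᵐ[P] AgnosticVoter.redInfluence μ P S 0 ∧
      ∀ s₀ : AgnosticVoter.Config V, (∀ᵐ ω ∂P, S 0 ω = s₀) →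
        ∀ᵐ ω ∂P, P.real (AgnosticVoter.redWins S) = AgnosticVoter.redInfluence μ P S 0 ω) := by
  refine ⟨AgnosticVoter.martingale_redInfluence hS hH.sum_row hrev, fun hsum hconv => ?_⟩
  have hwins := AgnosticVoter.condExp_redWins hS hH.sum_row hrev hsum hconv
  refine ⟨hwins, fun s₀ hs₀ => ?_⟩
  have hconst := condExp_comap_ae_eq_integral_of_ae_eq_const (hS.measurable 0) hs₀
    ((stronglyMeasurable_const (b := (1 : ℝ))).indicator
      (AgnosticVoter.measurableSet_redWins hS.measurable))
  filter_upwards [hconst, hwins] with ω hω hω'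
  rw [← hω', hω]
  exact (integral_indicator_one (AgnosticVoter.measurableSet_redWins hS.measurable)).symm
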